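/- Let $\mathcal H\simeq\mathbb C^n$ be a finite-dimensional Hilbert space, let $\rho\in\mathfrak B(\mathcal H)$ be positive definite (hence of full rank; no normalization of the trace is assumed), and let $\mathscr A\subseteq\mathfrak B(\mathcal H)$ be a $*$-subalgebra containing the identity. Put $\mathcal D_\rho(X)=\rho^{1/2}X\rho^{1/2}$ and $\mathscr A_\rho=\mathcal D_\rho(\mathscr A)$. A conditional expectation onto $\mathscr A$ is a completely positive unital linear map $\mathbb E:\mathfrak B(\mathcal H)\to\mathscr A$ with $\mathbb E(AB)=A\,\mathbb E(B)$ for all $A\in\mathscr A$, $B\in\mathfrak B(\mathcal H)$. A state extension $\mathbb J|_{\mathscr A}$ is the dual of such a map $\mathbb E$ for the Hilbert--Schmidt inner product, that is, the linear map $\mathbb J|_{\mathscr A}$ on $\mathfrak B(\mathcal H)$ with $\operatorname{tr}(\mathbb J|_{\mathscr A}(X)^\dagger Y)=\operatorname{tr}(X^\dagger\,\mathbb E(Y))$ for all $X,Y\in\mathfrak B(\mathcal H)$. A Wedderburn decomposition of $\mathscr A$ consists of finitely many pairs of nonzero finite-dimensional Hilbert spaces $\mathcal H_{S,l},\mathcal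 H_{F,l}$ and a unitary $U:\bigoplus_l\mathcal H_{S,l}\otimes\mathcal H_{F,l}\to\mathcal H$ with $$\mathscr A=U\Big(\bigoplus_l\mathfrak B(\mathcal H_{S,l})\otimes I_{F,l}\Big)U^\dagger .$$ The operator $\rho$ is compatible with $\mathscr A$, written $\rho\sim\mathscr A$, if in some Wedderburn decomposition of $\mathscr A$ it has the block form $$\rho=U\Big(\bigoplus_l\rho_{S,l}\otimes\tau_{F,l}\Big)U^\dagger,$$ with positive semidefinite $\rho_{S,l}\in\mathfrak B(\mathcal H_{S,l})$ and density operators $\tau_{F,l}\in\mathfrak B(\mathcal H_{F,l})$ (positive semidefinite of trace one). Then the following conditions are equivalent: 1. there exists a state extension $\mathbb J|_{\mathscr A}$ with $\operatorname{Im}(\mathbb J|_{\mathscr A})=\operatorname{fix}(\mathbb J|_{\mathscr A})=\mathscr A_\rho$, where $\operatorname{fix}(\mathbb J|_{\mathscr A})=\{X:\mathbb J|_{\mathscr A}(X)=X\}$; 2. $\rho\sim\mathscr A$. Moreover, compatibility does not depend on the decomposition: in any given Wedderburn decomposition of $\mathscr A$, $\rho$ has the block form above if and only if $\rho\sim\mathscr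 A$. -/

import Mathlib

open scoped Matrix Kronecker CStarAlgebra ComplexOrder MatrixOrder Matrix.Norms.L2Operator

/-- The symmetric multiplication `D_Y(X) = Y^{1/2} X Y^{1/2}` by the square root of a positive
matrix `Y`. -/
noncomputable def distort {n : Type*} [Fintype n] [DecidableEq n] (Y X : Matrix n n ℂ) :
    Matrix n n ℂ :=
  CFC.sqrt Y * X * CFC.sqrt Y

/-- The `ρ`-distorted algebra `D_ρ(A) = {ρ^{1/2} X ρ^{1/2} | X ∈ A}`. -/
def distortedAlgebra {n : Type*} [Fintype n] [DecidableEq n] (ρ : Matrix n n ℂ)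
    (A : StarSubalgebra ℂ (Matrix n n ℂ)) : Set (Matrix n n ℂ) :=
  distort ρ '' (A : Set (Matrix n n ℂ))

/-- A conditional expectation onto the unital `*`-algebra `A`: a completely positive, unital map
with values in `A` such that `E(XY) = X E(Y)` for `X ∈ A`. -/
structure IsConditionalExpectation {n : Type*} [Fintype n] [DecidableEq n]
    (A : StarSubalgebra ℂ (Matrix n n ℂ)) (E : Matrix n n ℂ →CP Matrix n n ℂ) : Prop where
  mem (X : Matrix n n ℂ) : E X ∈ A
  map_one : E 1 = 1
  map_mul (X Y : Matrix n n ℂ) (hX : X ∈ A) : E (X * Y) = X * E Y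

/-- A state extension for `A`: the dual of a conditional expectation onto `A` with respect to the
Hilbert-Schmidt inner product `⟨X, Y⟩ = tr(Xᴴ Y)`. -/
def IsStateExtension {n : Type*} [Fintype n] [DecidableEq n]
    (A : StarSubalgebra ℂ (Matrix n n ℂ)) (J : Matrix n n ℂ →ₗ[ℂ] Matrix n n ℂ) : Prop :=
  ∃ E : Matrix n n ℂ →CP Matrix n n ℂ, IsConditionalExpectation A E ∧
    ∀ X Y : Matrix n n ℂ, ((J X)ᴴ * Y).trace = (Xᴴ * E Y).trace

/-- A Wedderburn decomposition of the unital `*`-algebra `A`: a unitary `U` from an orthogonal sum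
`⨁ l, ℂ^(dS l) ⊗ ℂ^(dF l)` of tensor products of nonzero spaces onto `ℂ^n` such that
`A = U (⨁ l, B(ℂ^(dS l)) ⊗ 1) Uᴴ`. -/
structure WedderburnDecomposition {n : Type*} [Fintype n] [DecidableEq n]
    (A : StarSubalgebra ℂ (Matrix n n ℂ)) where
  numBlocks : ℕ
  dS : Fin numBlocks → ℕ
  dF : Fin numBlocks → ℕ
  dS_pos : ∀ l, 0 < dS l
  dF_pos : ∀ l, 0 < dF l
  U : Matrix n (Σ l : Fin numBlocks, Fin (dS l) × Fin (dF l)) ℂ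
  conjTranspose_mul_self : Uᴴ * U = 1
  mul_conjTranspose_self : U * Uᴴ = 1
  mem_iff : ∀ X : Matrix n n ℂ, X ∈ A ↔
    ∃ M : ∀ l, Matrix (Fin (dS l)) (Fin (dS l)) ℂ,
      X = U * Matrix.blockDiagonal'
        (fun l => M l ⊗ₖ (1 : Matrix (Fin (dF l)) (Fin (dF l)) ℂ)) * Uᴴ

/-- A density matrix: positive semidefinite of trace one. -/
def IsDensityMatrix {m : Type*} [Fintype m] (τ : Matrix m m ℂ) : Prop :=
  τ.PosSemidef ∧ τ.trace = 1

/-- `ρ` has the block form `ρ = U (⨁ l, ρS l ⊗ τ l) Uᴴ` in the Wedderburn decomposition `W`, with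
positive operators `ρS l` and density operators `τ l`. -/
def WedderburnDecomposition.HasBlockForm {n : Type*} [Fintype n] [DecidableEq n]
    {A : StarSubalgebra ℂ (Matrix n n ℂ)} (W : WedderburnDecomposition A)
    (ρ : Matrix n n ℂ) : Prop :=
  ∃ (ρS : ∀ l, Matrix (Fin (W.dS l)) (Fin (W.dS l)) ℂ)
    (τ : ∀ l, Matrix (Fin (W.dF l)) (Fin (W.dF l)) ℂ),
    (∀ l, (ρS l).PosSemidef) ∧ (∀ l, IsDensityMatrix (τ l)) ∧
      ρ = W.U * Matrix.blockDiagonal' (fun l => ρS l ⊗ₖ τ l) * W.Uᴴ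

/-- `ρ` is compatible with the unital `*`-algebra `A`, written `ρ ∼ A`. -/
def IsCompatible {n : Type*} [Fintype n] [DecidableEq n] (ρ : Matrix n n ℂ)
    (A : StarSubalgebra ℂ (Matrix n n ℂ)) : Prop :=
  ∃ W : WedderburnDecomposition A, W.HasBlockForm ρ

/-! The pivot is a condition free of any decomposition: `ρ` normalizes `A`, meaning that each `ρ *
X` with `X ∈ A` equals `Y * ρ` for some `Y ∈ A`.

If the dual `J` of `E` has fixed points `A_ρ`, then `J ρ = ρ`, and the module property of `E`
dualizes to `J (a * ρ) = a * ρ` for `a ∈ A`. Hence `a * ρ` lies in `A_ρ`; cancelling one `ρ^{1/2}`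
shows that `ρ^{1/2}`, and therefore `ρ`, normalizes `A` (`IsStateExtension.normalizes`).

A positive definite matrix normalizing `⨁ B ⊗ 1` has invertible diagonal blocks. These force the
parts between different summands to vanish, and within a summand they reduce everything to the fact
that only scalars commute with a full matrix algebra (`PosDef.exists_eq_blockKronecker`). So
normalization gives the block form in every Wedderburn decomposition. The same lemma, applied to `Sᴴ
* S`, turns a similarity `S` onto a block algebra into a unitary; the similarity itself comes from
semisimplicity, Schur's lemma and Jacobson density.

Conversely, the block form with weights `τ l` yields the state extension `X ↦ ⨁ tr_F(X_l) ⊗ τ l`,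
with `X_l` the `l`-th diagonal block in the decomposition. Its image and its fixed points are both
`⨁ B ⊗ τ l = A_ρ`. -/

/-! ### Block diagonal matrices of Kronecker products -/

namespace Matrix

/-- The block matrix `⨁ l, M l ⊗ T l`. -/
noncomputable def blockKronecker {o : Type*} [DecidableEq o] {p q : o → Type*}
    (M : ∀ l, Matrix (p l) (p l) ℂ) (T : ∀ l, Matrix (q l) (q l) ℂ) :
    Matrix (Σ l, p l × q l) (Σ l, p l × q l) ℂ :=
  blockDiagonal' fun l => M l ⊗ₖ T l

section blockKronecker

variable {o : Type*} [DecidableEq o] {p q : o → Type*}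

theorem blockKronecker_apply_eq (M : ∀ l, Matrix (p l) (p l) ℂ) (T : ∀ l, Matrix (q l) (q l) ℂ)
    (l : o) (x y : p l × q l) :
    blockKronecker M T ⟨l, x⟩ ⟨l, y⟩ = M l x.1 y.1 * T l x.2 y.2 := by
  simp [blockKronecker, blockDiagonal'_apply_eq]

theorem blockKronecker_apply_ne (M : ∀ l, Matrix (p l) (p l) ℂ) (T : ∀ l, Matrix (q l) (q l) ℂ)
    {l l' : o} (h : l ≠ l') (x : p l × q l) (y : p l' × q l') :
    blockKronecker M T ⟨l, x⟩ ⟨l', y⟩ = 0 := by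
  simp [blockKronecker, blockDiagonal'_apply_ne, h]

theorem conjTranspose_blockKronecker (M : ∀ l, Matrix (p l) (p l) ℂ)
    (T : ∀ l, Matrix (q l) (q l) ℂ) :
    (blockKronecker M T)ᴴ = blockKronecker (fun l => (M l)ᴴ) fun l => (T l)ᴴ := by
  simp [blockKronecker, blockDiagonal'_conjTranspose, conjTranspose_kronecker]

theorem blockKronecker_one [∀ l, DecidableEq (p l)] [∀ l, DecidableEq (q l)] :
    blockKronecker (fun l => (1 : Matrix (p l) (p l) ℂ)) (fun l => (1 : Matrix (q l) (q l) ℂ)) =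
      1 := by
  simp only [blockKronecker, one_kronecker_one]
  exact blockDiagonal'_one

variable [Fintype o] [∀ l, Fintype (p l)] [∀ l, Fintype (q l)]

theorem blockKronecker_mul (M M' : ∀ l, Matrix (p l) (p l) ℂ) (T T' : ∀ l, Matrix (q l) (q l) ℂ) :
    blockKronecker M T * blockKronecker M' T' =
      blockKronecker (fun l => M l * M' l) fun l => T l * T' l := by
  simp [blockKronecker, ← blockDiagonal'_mul, mul_kronecker_mul]

theorem PosSemidef.blockKronecker [∀ l, DecidableEq (p l)] [∀ l, DecidableEq (q l)]
    {M : ∀ l, Matrix (p l) (p l) ℂ} {T : ∀ l, Matrix (q l) (q l) ℂ}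
    (hM : ∀ l, (M l).PosSemidef) (hT : ∀ l, (T l).PosSemidef) :
    (Matrix.blockKronecker M T).PosSemidef := by
  choose R hR using fun l => CStarAlgebra.nonneg_iff_eq_star_mul_self.mp (hM l).nonneg
  choose S hS using fun l => CStarAlgebra.nonneg_iff_eq_star_mul_self.mp (hT l).nonneg
  have : Matrix.blockKronecker M T = (Matrix.blockKronecker R S)ᴴ * Matrix.blockKronecker R S := by
    rw [conjTranspose_blockKronecker, blockKronecker_mul]
    congr 1
    · exact funext hR
    · exact funext hS
  rw [this]
  exact posSemidef_conjTranspose_mul_self _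

/-- A positive definite matrix that normalizes the algebra of the matrices `⨁ l, M l ⊗ 1` is itself
a sum of Kronecker products of positive definite matrices. -/
theorem PosDef.exists_eq_blockKronecker [∀ l, DecidableEq (p l)] [∀ l, DecidableEq (q l)]
    [∀ l, Nonempty (p l)] [∀ l, Nonempty (q l)]
    {P : Matrix (Σ l, p l × q l) (Σ l, p l × q l) ℂ} (hP : P.PosDef)
    (h : ∀ M : ∀ l, Matrix (p l) (p l) ℂ, ∃ N : ∀ l, Matrix (p l) (p l) ℂ,
      P * Matrix.blockKronecker M (fun l => (1 : Matrix (q l) (q l) ℂ)) =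
        Matrix.blockKronecker N (fun l => (1 : Matrix (q l) (q l) ℂ)) * P) :
    ∃ (R : ∀ l, Matrix (p l) (p l) ℂ) (T : ∀ l, Matrix (q l) (q l) ℂ),
      (∀ l, (R l).PosDef) ∧ (∀ l, (T l).PosDef) ∧ (∀ l, (T l).trace = 1) ∧
        P = Matrix.blockKronecker R T := by
  classical
  -- Fixing the indices of the second factors cuts `P` into blocks acting between first factors; the
  -- hypothesis becomes an intertwining relation for each block separately.
  let Q : ∀ l, q l → ∀ l', q l' → Matrix (p l) (p l') ℂ :=
    fun l j l' j' => P.submatrix (fun i => ⟨l, i, j⟩) fun i => ⟨l', i, j'⟩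
  choose N hN using h
  have hQ : ∀ M l j l' j', Q l j l' j' * M l' = N M l * Q l j l' j' := by
    intro M l j l' j'
    ext i i'
    have := congrFun (congrFun (hN M) ⟨l, i, j⟩) ⟨l', i', j'⟩
    rw [mul_apply, mul_apply, Fintype.sum_sigma, Fintype.sum_sigma,
      Finset.sum_eq_single_of_mem l' (Finset.mem_univ _),
      Finset.sum_eq_single_of_mem l (Finset.mem_univ _), Fintype.sum_prod_type,
      Fintype.sum_prod_type] at this
    · simpa [blockKronecker_apply_eq, one_apply, mul_apply, Q] using this
    · intro b _ hb
      simp [blockKronecker_apply_ne _ _ hb.symm]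
    · intro b _ hb
      simp [blockKronecker_apply_ne _ _ hb]
  have hpd : ∀ l j, (Q l j l j).PosDef := fun l j =>
    hP.submatrix (e := fun i => (⟨l, i, j⟩ : Σ l, p l × q l)) fun a b hab => by simpa using hab
  have hoff : ∀ l j l' j', l ≠ l' → Q l j l' j' = 0 := by
    intro l j l' j' hne
    -- Testing on the central projection of summand `l'`: the invertible diagonal block at `l`
    -- forces `N M l = 0`, which kills the block from `l'` to `l`.
    let M : ∀ l, Matrix (p l) (p l) ℂ := Pi.single l' 1
    have h1 := hQ M l j l' j'
    have h2 := hQ M l j l j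
    have hM' : M l' = 1 := by simp [M]
    have hM : M l = 0 := by simp [M, hne]
    rw [hM, mul_zero, eq_comm, (hpd l j).isUnit.mul_left_eq_zero] at h2
    rw [hM', Matrix.mul_one, h2, Matrix.zero_mul] at h1
    exact h1
  let i₀ : ∀ l, p l := fun l => Classical.arbitrary _
  let j₀ : ∀ l, q l := fun l => Classical.arbitrary _
  have hscalar : ∀ l j j', ∃ c : ℂ, Q l j l j' = c • Q l (j₀ l) l (j₀ l) := by
    intro l j j'
    obtain ⟨u, hu⟩ := (hpd l (j₀ l)).isUnit
    -- All blocks inside summand `l` intertwine `X` with the same matrix `u * X * u⁻¹`, so dividing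
    -- by `u` leaves something that commutes with every `X`.
    have hcomm : ∀ X : Matrix (p l) (p l) ℂ,
        Commute X ((↑u⁻¹ : Matrix (p l) (p l) ℂ) * Q l j l j') := by
      intro X
      let M : ∀ l, Matrix (p l) (p l) ℂ := Pi.single l X
      have hM : M l = X := by simp [M]
      have h1 := hQ M l j l j'
      have h2 := hQ M l (j₀ l) l (j₀ l)
      rw [hM] at h1 h2
      rw [← hu] at h2
      have h3 : N M l = u * X * (↑u⁻¹ : Matrix (p l) (p l) ℂ) := by
        rw [h2, mul_assoc, Units.mul_inv, mul_one]
      rw [Commute, SemiconjBy, mul_assoc, h1, h3]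
      simp only [← mul_assoc, Units.inv_mul, one_mul]
    obtain ⟨c, hc⟩ := mem_range_scalar_of_commute_single (M := (↑u⁻¹ : Matrix (p l) (p l) ℂ) *
      Q l j l j') fun _ _ _ => hcomm _
    refine ⟨c, ?_⟩
    have : (u : Matrix (p l) (p l) ℂ) * ((↑u⁻¹ : Matrix (p l) (p l) ℂ) * Q l j l j') =
        Q l j l j' := by
      rw [← mul_assoc, Units.mul_inv, one_mul]
    rw [← this, ← hc, hu]
    ext i i'
    simp [mul_comm c]
  choose c hc using hscalar
  -- The coefficients `c l` are, up to a positive factor, a principal submatrix of `P`, which makes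
  -- their positive definiteness immediate.
  let T₀ : ∀ l, Matrix (q l) (q l) ℂ := fun l =>
    P.submatrix (fun j => ⟨l, i₀ l, j⟩) fun j => ⟨l, i₀ l, j⟩
  have hT₀ : ∀ l, (T₀ l).PosDef := fun l =>
    hP.submatrix (e := fun j => (⟨l, i₀ l, j⟩ : Σ l, p l × q l)) fun a b hab => by simpa using hab
  have ht : ∀ l, 0 < (T₀ l).trace := fun l => (hT₀ l).trace_pos
  have hr : ∀ l, 0 < Q l (j₀ l) l (j₀ l) (i₀ l) (i₀ l) := fun l => (hpd l (j₀ l)).diag_pos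
  refine ⟨fun l => ((T₀ l).trace / Q l (j₀ l) l (j₀ l) (i₀ l) (i₀ l)) • Q l (j₀ l) l (j₀ l),
    fun l => (T₀ l).trace⁻¹ • T₀ l, fun l => (hpd l _).smul (div_pos (ht l) (hr l)),
    fun l => (hT₀ l).smul (inv_pos.mpr (ht l)), fun l => ?_, ?_⟩
  · rw [trace_smul, smul_eq_mul, inv_mul_cancel₀ (ht l).ne']
  · ext ⟨l, i, j⟩ ⟨l', i', j'⟩
    by_cases hl : l = l'
    · subst hl
      have h1 : P ⟨l, i, j⟩ ⟨l, i', j'⟩ = c l j j' * Q l (j₀ l) l (j₀ l) i i' :=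
        congrFun (congrFun (hc l j j') i) i'
      have h2 : T₀ l j j' = c l j j' * Q l (j₀ l) l (j₀ l) (i₀ l) (i₀ l) :=
        congrFun (congrFun (hc l j j') (i₀ l)) (i₀ l)
      have := (ht l).ne'
      have := (hr l).ne'
      rw [blockKronecker_apply_eq, smul_apply, smul_apply, h1, h2, smul_eq_mul, smul_eq_mul]
      field_simp
    · rw [blockKronecker_apply_ne _ _ hl]
      exact congrFun (congrFun (hoff l j l' j' hl) i) i'

end blockKronecker

end Matrix

/-! ### Semisimple modules and the density theorem -/

open Module in
/-- A simple module's endomorphisms are scalars (Schur's lemma). -/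
theorem IsSimpleModule.exists_eq_smul_of_isAlgClosed {R S : Type*} [Ring R] [Algebra ℂ R]
    [AddCommGroup S] [Module ℂ S] [Module R S] [IsScalarTower ℂ R S] [FiniteDimensional ℂ S]
    [IsSimpleModule R S] (f : S →ₗ[R] S) : ∃ c : ℂ, ∀ x, f x = c • x := by
  classical
  have : FiniteDimensional ℂ (End R S) :=
    FiniteDimensional.of_injective (LinearMap.restrictScalarsₗ ℂ R S S ℂ)
      (LinearMap.restrictScalars_injective ℂ)
  obtain ⟨c, hc⟩ := (IsAlgClosed.algebraMap_bijective_of_isIntegral (k := ℂ) (K := End R S)).2 f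
  exact ⟨c, fun x => by rw [← hc]; rfl⟩

open Module IsSemisimpleModule in
/-- In a suitable basis of a finite-dimensional semisimple module, the ring acts by exactly the
matrices `⨁ l, M l ⊗ 1`. -/
theorem IsSemisimpleModule.exists_basis_range_eq {R V : Type*} [Ring R] [Algebra ℂ R]
    [AddCommGroup V] [Module ℂ V] [Module R V] [IsScalarTower ℂ R V] [FiniteDimensional ℂ V]
    [IsSemisimpleModule R V] :
    ∃ (m : ℕ) (s d : Fin m → ℕ) (b : Basis (Σ l, Fin (s l) × Fin (d l)) ℂ V),
      (∀ l, 0 < s l) ∧ (∀ l, 0 < d l) ∧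
      ∀ f : End ℂ V, (∃ r : R, ∀ v, f v = r • v) ↔
        ∃ M : ∀ l, Matrix (Fin (s l)) (Fin (s l)) ℂ, ∀ l i j,
          f (b ⟨l, i, j⟩) = ∑ k, M l k i • b ⟨l, k, j⟩ := by
  classical
  have : IsNoetherian R V := isNoetherian_of_tower ℂ inferInstance
  obtain ⟨m, ⟨en⟩⟩ := Finite.exists_equiv_fin (isotypicComponents R V)
  let C : Fin m → Submodule R V := fun l => (en.symm l).1
  have hC : ∀ l, C l ∈ isotypicComponents R V := fun l => (en.symm l).2
  -- Each isotypic component is a power of one simple module `S l`, with multiplicity `d l`. The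
  -- basis places a basis of `S l` in each of the `d l` copies.
  choose d pos S hle simple e using fun l ↦
    (IsIsotypic.isotypicComponents (hC l)).submodule_linearEquiv_fun
  have e := fun l => (e l).some
  have hint : DirectSum.IsInternal fun l => (C l).restrictScalars ℂ := by
    have h1 : iSupIndep C :=
      ((sSupIndep_iff _).mp (sSupIndep_isotypicComponents R V)).comp en.symm.injective
    have h2 : iSup C = ⊤ := by
      rw [← sSup_isotypicComponents R V, sSup_eq_iSup']
      exact en.symm.iSup_comp (g := fun c : isotypicComponents R V => c.1)
    have := DirectSum.isInternal_submodule_of_iSupIndep_of_iSup_eq_top h1 h2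
    exact this
  have hfin : ∀ l, FiniteDimensional ℂ (S l) := fun l =>
    FiniteDimensional.finiteDimensional_submodule ((S l).restrictScalars ℂ)
  let B := fun l => finBasis ℂ (S l)
  let b₁ : ∀ l, Basis (Σ _ : Fin (d l), Fin (finrank ℂ (S l))) ℂ (C l) :=
    fun l => (Pi.basis fun _ => B l).map ((e l).restrictScalars ℂ).symm
  let b₂ : ∀ l, Basis (Fin (finrank ℂ (S l)) × Fin (d l)) ℂ ((C l).restrictScalars ℂ) :=
    fun l => (b₁ l).reindex ((Equiv.sigmaEquivProd _ _).trans (Equiv.prodComm _ _))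
  let b := hint.collectedBasis b₂
  have hb : ∀ l i j, b ⟨l, i, j⟩ = ((e l).symm (Pi.single j (B l i)) : V) := by
    intro l i j
    have h1 : b ⟨l, i, j⟩ = (b₂ l (i, j) : V) := congrFun (hint.collectedBasis_coe b₂) _
    have h2 : (b₂ l (i, j) : V) = (b₁ l ⟨j, i⟩ : V) :=
      congrArg Subtype.val ((b₁ l).reindex_apply _ _)
    have h3 : b₁ l ⟨j, i⟩ = (e l).symm (Pi.single j (B l i)) := by simp [b₁]
    rw [h1, h2, h3]
  have hsum : ∀ l j (x : S l), ((e l).symm (Pi.single j x) : V) =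
      ∑ k, (B l).repr x k • b ⟨l, k, j⟩ := by
    intro l j x
    let φ : S l →ₗ[ℂ] V := ((C l).subtype ∘ₗ (e l).symm.toLinearMap ∘ₗ
      LinearMap.single R (fun _ => S l) j).restrictScalars ℂ
    calc ((e l).symm (Pi.single j x) : V) = φ x := rfl
      _ = φ (∑ k, (B l).repr x k • B l k) := by rw [(B l).sum_repr]
      _ = ∑ k, (B l).repr x k • b ⟨l, k, j⟩ := by
        simp only [map_sum, map_smul, hb]
        rfl
  refine ⟨m, fun l => finrank ℂ (S l), d, b,
    fun l => finrank_pos_iff.mpr (IsSimpleModule.nontrivial R _),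
    fun l => Nat.pos_of_neZero _, fun f => ⟨?_, ?_⟩⟩
  · rintro ⟨r, hr⟩
    refine ⟨fun l k i => (B l).repr (r • B l i) k, fun l i j => ?_⟩
    rw [← hsum, hr, hb, ← Submodule.coe_smul, ← map_smul, ← Pi.single_smul]
  · rintro ⟨M, hM⟩
    -- An `R`-endomorphism preserves isotypic components, and by Schur's lemma its entries between
    -- copies of `S l` are scalars: it acts on the copy index `j` alone.
    have key : ∀ (T : End R V) l j, ∃ t : Fin (d l) → ℂ, ∀ i,
        T (b ⟨l, i, j⟩) = ∑ j', t j' • b ⟨l, i, j'⟩ := by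
      intro T l j
      have hT : ∀ x ∈ C l, T x ∈ C l := fun x hx =>
        (Submodule.IsFullyInvariant.of_mem_isotypicComponents (hC l)) T hx
      choose t ht using fun j' => IsSimpleModule.exists_eq_smul_of_isAlgClosed
        (LinearMap.proj j' ∘ₗ (e l).toLinearMap ∘ₗ (LinearMap.restrict T hT) ∘ₗ (e l).symm.toLinearMap ∘ₗ
          LinearMap.single R (fun _ => S l) j)
      refine ⟨t, fun i => ?_⟩
      have hmem : b ⟨l, i, j⟩ ∈ C l := by
        rw [hb]
        exact SetLike.coe_mem _
      have h1 : e l ⟨T (b ⟨l, i, j⟩), hT _ hmem⟩ = ∑ j', Pi.single j' (t j' • B l i) := by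
        rw [Finset.univ_sum_single]
        funext j'
        rw [← ht]
        simp [hb, LinearMap.restrict_apply]
      have h2 := congrArg (fun y => ((e l).symm y : V)) h1
      simp only [LinearEquiv.symm_apply_apply, map_sum, Submodule.coe_sum, hsum] at h2
      rw [h2]
      refine Finset.sum_congr rfl fun j' _ => ?_
      simp [Finsupp.single_apply]
    -- Since `f` acts only on `i` and `R`-endomorphisms only on `j`, `f` lies in the double
    -- commutant. Density then gives an `r` agreeing with `f` on the finite basis.
    let F : End (End R V) V :=
      { f with
        map_smul' := by
          intro T v
          have : f ∘ₗ T.restrictScalars ℂ = T.restrictScalars ℂ ∘ₗ f := by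
            refine b.ext fun ⟨l, i, j⟩ => ?_
            obtain ⟨t, ht⟩ := key T l j
            simp only [LinearMap.comp_apply, LinearMap.restrictScalars_apply, hM, ht, map_sum,
              map_smul, Finset.smul_sum]
            rw [Finset.sum_comm]
            simp only [smul_comm (M l _ i)]
          exact LinearMap.congr_fun this v }
    obtain ⟨r, hr⟩ := jacobson_density F (Finset.univ.image b)
    refine ⟨r, fun v => ?_⟩
    have : f = Module.toModuleEnd ℂ (S := R) V r := b.ext fun x => hr (b x) (by simp)
    rw [this]
    rfl

open Module in
/-- An algebra of operators on a finite-dimensional Hilbert space that is closed under adjoints is,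
in a suitable basis, the algebra of the matrices `⨁ l, M l ⊗ 1`. -/
theorem exists_basis_range_eq_of_adjoint {R E : Type*} [Ring R] [Algebra ℂ R]
    [NormedAddCommGroup E] [InnerProductSpace ℂ E] [FiniteDimensional ℂ E] (φ : R →ₐ[ℂ] (E →ₗ[ℂ] E))
    (hφ : ∀ r, ∃ r', φ r' = LinearMap.adjoint (φ r)) :
    ∃ (m : ℕ) (s d : Fin m → ℕ) (b : Basis (Σ l, Fin (s l) × Fin (d l)) ℂ E),
      (∀ l, 0 < s l) ∧ (∀ l, 0 < d l) ∧
      ∀ f : End ℂ E, (∃ r : R, φ r = f) ↔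
        ∃ M : ∀ l, Matrix (Fin (s l)) (Fin (s l)) ℂ, ∀ l i j,
          f (b ⟨l, i, j⟩) = ∑ k, M l k i • b ⟨l, k, j⟩ := by
  let : Module R E := Module.compHom E (φ : R →+* Module.End ℂ E)
  have hsmul : ∀ (r : R) (v : E), r • v = φ r v := fun _ _ => rfl
  have : IsScalarTower ℂ R E := ⟨fun c r v => by simp [hsmul]⟩
  have : IsSemisimpleModule R E := by
    refine { exists_isCompl := fun N => ?_ }
    let K : Submodule ℂ E := N.restrictScalars ℂ
    -- Closure under adjoints makes the orthogonal complement of an invariant subspace invariant.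
    let N' : Submodule R E :=
      { Kᗮ with
        smul_mem' := by
          intro r v hv u hu
          obtain ⟨r', hr'⟩ := hφ r
          have h1 : r' • u ∈ N := N.smul_mem _ hu
          have h2 := hv _ h1
          rw [hsmul, hr', LinearMap.adjoint_inner_left] at h2
          exact h2 }
    have hK : IsCompl K Kᗮ := K.isCompl_orthogonal
    refine ⟨N', ?_, ?_⟩
    · have := Submodule.disjoint_def.mp hK.disjoint
      rw [Submodule.disjoint_def]
      exact this
    · have := Submodule.codisjoint_iff_exists_add_eq.mp hK.codisjoint
      rw [Submodule.codisjoint_iff_exists_add_eq]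
      exact this
  obtain ⟨m, s, d, b, hs, hd, hb⟩ := IsSemisimpleModule.exists_basis_range_eq (R := R) (V := E)
  refine ⟨m, s, d, b, hs, hd, fun f => ?_⟩
  rw [← hb]
  refine exists_congr fun r => ?_
  rw [LinearMap.ext_iff]
  exact forall_congr' fun v => eq_comm

/-! ### Similarity to a block algebra -/

namespace StarSubalgebra

variable {n : Type*} [Fintype n] [DecidableEq n]

open Matrix in
/-- A unital `*`-algebra of matrices is similar to the algebra of the matrices `⨁ l, M l ⊗ 1`. -/
theorem exists_similar_blockKronecker (A : StarSubalgebra ℂ (Matrix n n ℂ)) :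
    ∃ (m : ℕ) (s d : Fin m → ℕ) (S : Matrix n (Σ l, Fin (s l) × Fin (d l)) ℂ)
      (T : Matrix (Σ l, Fin (s l) × Fin (d l)) n ℂ),
      (∀ l, 0 < s l) ∧ (∀ l, 0 < d l) ∧ S * T = 1 ∧ T * S = 1 ∧
      ∀ X, X ∈ A ↔ ∃ M : ∀ l, Matrix (Fin (s l)) (Fin (s l)) ℂ,
        X = S * blockKronecker M (fun l => (1 : Matrix (Fin (d l)) (Fin (d l)) ℂ)) * T := by
  let ψ : Matrix n n ℂ →ₐ[ℂ] (EuclideanSpace ℂ n →ₗ[ℂ] EuclideanSpace ℂ n) :=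
    (Matrix.toLinAlgEquiv (EuclideanSpace.basisFun n ℂ).toBasis).toAlgHom
  have hψ : ∀ X, ψ X = Matrix.toEuclideanLin X := fun X => by
    simp [ψ, Matrix.toEuclideanLin_eq_toLin_orthonormal]; rfl
  obtain ⟨m, s, d, b, hs, hd, hb⟩ :=
    exists_basis_range_eq_of_adjoint (R := A) (ψ.comp A.subtype.toAlgHom) fun r => by
      refine ⟨star r, ?_⟩
      change ψ (star r.1) = LinearMap.adjoint (ψ r.1)
      rw [hψ, hψ, Matrix.star_eq_conjTranspose, Matrix.toEuclideanLin_conjTranspose_eq_adjoint]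
  let e := (EuclideanSpace.basisFun n ℂ).toBasis
  have hST : e.toMatrix b * b.toMatrix e = 1 := e.toMatrix_mul_toMatrix_flip b
  have hTS : b.toMatrix e * e.toMatrix b = 1 := b.toMatrix_mul_toMatrix_flip e
  refine ⟨m, s, d, e.toMatrix b, b.toMatrix e, hs, hd, hST, hTS, fun X => ?_⟩
  have h1 : X ∈ A ↔ ∃ r : A, ψ r.1 = ψ X := by
    refine ⟨fun hX => ⟨⟨X, hX⟩, rfl⟩, fun ⟨r, hr⟩ => ?_⟩
    have : r.1 = X := (Matrix.toLinAlgEquiv (EuclideanSpace.basisFun n ℂ).toBasis).injective hr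
    exact this ▸ r.2
  rw [h1]
  refine (hb _).trans (exists_congr fun M => ?_)
  have h2 : X = e.toMatrix b * blockKronecker M (fun l => (1 : Matrix (Fin (d l)) (Fin (d l)) ℂ)) *
      b.toMatrix e ↔
      X * e.toMatrix b =
        e.toMatrix b * blockKronecker M (fun l => (1 : Matrix (Fin (d l)) (Fin (d l)) ℂ)) := by
    constructor
    · intro h
      rw [h, Matrix.mul_assoc, hTS, Matrix.mul_one]
    · intro h
      rw [← h, Matrix.mul_assoc, hST, Matrix.mul_one]
  have h3 : ∀ x y, e.toMatrix b x y = b y x := fun x y => by simp [e, Module.Basis.toMatrix_apply]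
  -- The columns of `e.toMatrix b` are the vectors of `b`, so the matrix identity is the action on
  -- `b` read column by column.
  rw [h2, ← Matrix.ext_iff]
  have h4 : ∀ x l i j, (X * e.toMatrix b) x ⟨l, i, j⟩ = ψ X (b ⟨l, i, j⟩) x := by
    intro x l i j
    rw [hψ, Matrix.mul_apply]
    simp [Matrix.mulVec, dotProduct, h3]
  have h5 : ∀ x l i j, (e.toMatrix b *
      blockKronecker M (fun l => (1 : Matrix (Fin (d l)) (Fin (d l)) ℂ))) x ⟨l, i, j⟩ =
      (∑ k, M l k i • b ⟨l, k, j⟩) x := by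
    intro x l i j
    rw [Matrix.mul_apply, Fintype.sum_sigma, Finset.sum_eq_single_of_mem l (Finset.mem_univ _),
      Fintype.sum_prod_type]
    · simp [blockKronecker_apply_eq, h3, Matrix.one_apply, mul_comm]
    · intro l' _ hl
      simp [blockKronecker_apply_ne _ _ hl]
  constructor
  · rintro h x ⟨l, i, j⟩
    rw [h4, h5, ← h]
  · intro h l i j
    ext x
    rw [← h5, ← h, h4]

end StarSubalgebra

/-! ### Factors and square roots of positive definite matrices -/

namespace Matrix

section blockKronecker

variable {o : Type*} [DecidableEq o] {p q : o → Type*} [Fintype o] [∀ l, Fintype (p l)]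
  [∀ l, Fintype (q l)] [∀ l, DecidableEq (p l)] [∀ l, DecidableEq (q l)]

/-- The factors `T l` commute with `1`, so only the `R l` take part in the conjugation and `T l`
need not be invertible. -/
theorem blockKronecker_mul_blockKronecker_one {R R' : ∀ l, Matrix (p l) (p l) ℂ}
    (hR : ∀ l, R' l * R l = 1) (T : ∀ l, Matrix (q l) (q l) ℂ) (M : ∀ l, Matrix (p l) (p l) ℂ) :
    blockKronecker R T * blockKronecker M (fun l => (1 : Matrix (q l) (q l) ℂ)) =
      blockKronecker (fun l => R l * M l * R' l) (fun l => (1 : Matrix (q l) (q l) ℂ)) *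
        blockKronecker R T := by
  simp [blockKronecker_mul, Matrix.mul_assoc, hR]

omit [Fintype o] in
-- The determinant of the principal block `R l ⊗ T l` contains a positive power of `det (R l)`, so
-- `R l` is invertible as well as semidefinite.
theorem posDef_of_posDef_blockKronecker [∀ l, Nonempty (p l)] [∀ l, Nonempty (q l)]
    {R : ∀ l, Matrix (p l) (p l) ℂ} {T : ∀ l, Matrix (q l) (q l) ℂ}
    (hR : ∀ l, (R l).PosSemidef) (h : (blockKronecker R T).PosDef) (l : o) : (R l).PosDef := by
  have h1 : ((blockKronecker R T).submatrix (Sigma.mk l) (Sigma.mk l)).PosDef :=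
    h.submatrix sigma_mk_injective
  have h2 : (blockKronecker R T).submatrix (Sigma.mk l) (Sigma.mk l) = R l ⊗ₖ T l := by
    ext x y
    simp [blockKronecker_apply_eq, kroneckerMap_apply]
  have h3 := h1.det_pos.ne'
  rw [h2, det_kronecker] at h3
  rw [(hR l).posDef_iff_isUnit, isUnit_iff_isUnit_det, isUnit_iff_ne_zero]
  intro h0
  simp [h0, Fintype.card_ne_zero] at h3

end blockKronecker

theorem PosDef.isUnit_sqrt {m : Type*} [Fintype m] [DecidableEq m] {R : Matrix m m ℂ}
    (hR : R.PosDef) : IsUnit (CFC.sqrt R) := by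
  have h : IsUnit (CFC.sqrt R * CFC.sqrt R) := by
    rw [CFC.sqrt_mul_sqrt_self R hR.posSemidef.nonneg]
    exact hR.isUnit
  exact isUnit_of_mul_isUnit_left h

theorem PosDef.exists_posDef_mul_self {m : Type*} [Fintype m] [DecidableEq m] {R : Matrix m m ℂ}
    (hR : R.PosDef) : ∃ r : Matrix m m ℂ, r.PosDef ∧ r * r = R :=
  ⟨CFC.sqrt R, (nonneg_iff_posSemidef.mp (CFC.sqrt_nonneg R)).posDef_iff_isUnit.mpr hR.isUnit_sqrt,
    CFC.sqrt_mul_sqrt_self R hR.posSemidef.nonneg⟩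

end Matrix

/-! ### Existence of a Wedderburn decomposition -/

open Matrix

/-- Every unital `*`-algebra of matrices has a Wedderburn decomposition. -/
theorem StarSubalgebra.nonempty_wedderburnDecomposition {n : Type*} [Fintype n] [DecidableEq n]
    (A : StarSubalgebra ℂ (Matrix n n ℂ)) : Nonempty (WedderburnDecomposition A) := by
  obtain ⟨m, s, d, S, T, hs, hd, hST, hTS, hA⟩ := A.exists_similar_blockKronecker
  have := fun l => Fin.pos_iff_nonempty.mp (hs l)
  have := fun l => Fin.pos_iff_nonempty.mp (hd l)
  have hP : (Sᴴ * S).PosDef := PosDef.conjTranspose_mul_self _ fun v w h => by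
    simpa [hTS] using congrArg (T *ᵥ ·) h
  -- Closure of `A` under adjoints says exactly that `Sᴴ * S` normalizes the block algebra: compare
  -- `S * M * T` with the adjoint of the block expression for its star.
  obtain ⟨R, τ, hR, hτ, -, hRτ⟩ := hP.exists_eq_blockKronecker fun M => by
    obtain ⟨K, hK⟩ := (hA _).mp (star_mem ((hA _).mpr ⟨M, rfl⟩))
    refine ⟨fun l => (K l)ᴴ, ?_⟩
    have h1 := congrArg star hK
    rw [star_star, star_eq_conjTranspose, conjTranspose_mul, conjTranspose_mul,
      conjTranspose_blockKronecker] at h1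
    simp only [conjTranspose_one] at h1
    have h2 := congrArg (fun Z => Sᴴ * Z * S) h1
    simp only [Matrix.mul_assoc, hTS, Matrix.mul_one] at h2
    simp only [← Matrix.mul_assoc, ← conjTranspose_mul, hTS, conjTranspose_one,
      Matrix.one_mul] at h2
    rwa [Matrix.mul_assoc _ Sᴴ S] at h2
  choose r hr hrr using fun l => (hR l).exists_posDef_mul_self
  choose t ht htt using fun l => (hτ l).exists_posDef_mul_self
  -- Polar decomposition: `Q` is a square root of `Sᴴ * S` and `S * Q⁻¹` is the unitary part. Being
  -- a block product, `Q` conjugates the block algebra onto itself.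
  set Q := blockKronecker r t with hQdef
  have hQQ : Q * Q = Sᴴ * S := by
    rw [hRτ, blockKronecker_mul]
    simp only [hrr, htt]
  have hQ : Qᴴ = Q := by
    rw [conjTranspose_blockKronecker]
    simp only [(hr _).isHermitian.eq, (ht _).isHermitian.eq, hQdef]
  have hQdet : IsUnit Q.det := by
    have := hP.det_pos.ne'.isUnit
    rw [← hQQ, det_mul] at this
    exact isUnit_of_mul_isUnit_left this
  have hQ1 : Q * Q⁻¹ = 1 := mul_nonsing_inv _ hQdet
  have hQ2 : Q⁻¹ * Q = 1 := nonsing_inv_mul _ hQdet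
  have hQi : (Q⁻¹)ᴴ = Q⁻¹ := by rw [conjTranspose_nonsing_inv, hQ]
  have hr1 : ∀ l, r l * (r l)⁻¹ = 1 := fun l => mul_nonsing_inv _ (hr l).det_pos.ne'.isUnit
  have hr2 : ∀ l, (r l)⁻¹ * r l = 1 := fun l => nonsing_inv_mul _ (hr l).det_pos.ne'.isUnit
  have hU : (S * Q⁻¹)ᴴ * (S * Q⁻¹) = 1 := by
    rw [conjTranspose_mul, hQi, Matrix.mul_assoc, ← Matrix.mul_assoc Sᴴ, ← hQQ,
      Matrix.mul_assoc Q, hQ1, Matrix.mul_one, hQ2]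
  have hUT : (S * Q⁻¹) * (Q * T) = 1 := by
    rw [Matrix.mul_assoc, ← Matrix.mul_assoc Q⁻¹, hQ2, Matrix.one_mul, hST]
  have hUH : (S * Q⁻¹)ᴴ = Q * T := by
    rw [← Matrix.mul_one (S * Q⁻¹)ᴴ, ← hUT, ← Matrix.mul_assoc, hU, Matrix.one_mul]
  have hconj : ∀ M : ∀ l, Matrix (Fin (s l)) (Fin (s l)) ℂ,
      S * blockKronecker M (fun l => (1 : Matrix (Fin (d l)) (Fin (d l)) ℂ)) * T =
        S * Q⁻¹ * blockKronecker (fun l => r l * M l * (r l)⁻¹)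
          (fun l => (1 : Matrix (Fin (d l)) (Fin (d l)) ℂ)) * (Q * T) := by
    intro M
    rw [← Matrix.mul_assoc _ Q, Matrix.mul_assoc _ _ Q, hQdef,
      ← blockKronecker_mul_blockKronecker_one hr2, ← hQdef, ← Matrix.mul_assoc _ Q,
      Matrix.mul_assoc S Q⁻¹ Q, hQ2, Matrix.mul_one]
  refine ⟨⟨m, s, d, hs, hd, S * Q⁻¹, hU, by rw [hUH, hUT], fun X => ?_⟩⟩
  rw [hA, hUH]
  constructor
  · rintro ⟨M, rfl⟩
    exact ⟨_, hconj M⟩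
  · rintro ⟨M, rfl⟩
    refine ⟨fun l => (r l)⁻¹ * M l * r l, ?_⟩
    rw [hconj]
    simp only [Matrix.mul_assoc, hr1, Matrix.mul_one]
    simp only [← Matrix.mul_assoc, hr1, Matrix.one_mul]
    rfl

/-! ### Block form as normalization of the algebra -/

namespace WedderburnDecomposition

variable {n : Type*} [Fintype n] [DecidableEq n] {A : StarSubalgebra ℂ (Matrix n n ℂ)}
  (W : WedderburnDecomposition A)

instance (l : Fin W.numBlocks) : Nonempty (Fin (W.dS l)) := Fin.pos_iff_nonempty.mp (W.dS_pos l)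

instance (l : Fin W.numBlocks) : Nonempty (Fin (W.dF l)) := Fin.pos_iff_nonempty.mp (W.dF_pos l)

theorem mem_iff_blockKronecker (X : Matrix n n ℂ) : X ∈ A ↔
    ∃ M : ∀ l, Matrix (Fin (W.dS l)) (Fin (W.dS l)) ℂ,
      X = W.U * blockKronecker M (fun l => (1 : Matrix (Fin (W.dF l)) (Fin (W.dF l)) ℂ)) * W.Uᴴ :=
  W.mem_iff X

theorem conj_mul_conj (X Y : Matrix (Σ l, Fin (W.dS l) × Fin (W.dF l))
    (Σ l, Fin (W.dS l) × Fin (W.dF l)) ℂ) :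
    W.U * X * W.Uᴴ * (W.U * Y * W.Uᴴ) = W.U * (X * Y) * W.Uᴴ := by
  rw [Matrix.mul_assoc _ W.Uᴴ, Matrix.mul_assoc W.U Y, ← Matrix.mul_assoc W.Uᴴ,
    W.conjTranspose_mul_self, Matrix.one_mul]
  simp only [Matrix.mul_assoc]

theorem conj_injective : Function.Injective fun X : Matrix (Σ l, Fin (W.dS l) × Fin (W.dF l))
    (Σ l, Fin (W.dS l) × Fin (W.dF l)) ℂ => W.U * X * W.Uᴴ := by
  intro X Y h
  have h1 := congrArg (fun Z => W.Uᴴ * Z * W.U) h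
  simpa only [Matrix.mul_assoc, W.conjTranspose_mul_self, Matrix.mul_one, ← Matrix.mul_assoc W.Uᴴ,
    Matrix.one_mul] using h1

theorem mulVec_U_injective : Function.Injective W.U.mulVec := fun v w h => by
  simpa [W.conjTranspose_mul_self] using congrArg (W.Uᴴ *ᵥ ·) h

theorem conj_conjTranspose_mul (X : Matrix n n ℂ) : W.U * (W.Uᴴ * X * W.U) * W.Uᴴ = X := by
  simp only [Matrix.mul_assoc, W.mul_conjTranspose_self, Matrix.mul_one]
  rw [← Matrix.mul_assoc, W.mul_conjTranspose_self, Matrix.one_mul]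

theorem conjTranspose_mul_conj (X : Matrix (Σ l, Fin (W.dS l) × Fin (W.dF l))
    (Σ l, Fin (W.dS l) × Fin (W.dF l)) ℂ) : W.Uᴴ * (W.U * X * W.Uᴴ) * W.U = X :=
  W.conj_injective (W.conj_conjTranspose_mul _)

/-- A positive definite matrix in block form has a positive definite first factor in each block. -/
theorem HasBlockForm.exists_posDef {ρ : Matrix n n ℂ} (hρ : ρ.PosDef) (h : W.HasBlockForm ρ) :
    ∃ (R : ∀ l, Matrix (Fin (W.dS l)) (Fin (W.dS l)) ℂ)
      (τ : ∀ l, Matrix (Fin (W.dF l)) (Fin (W.dF l)) ℂ),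
      (∀ l, (R l).PosDef) ∧ (∀ l, IsDensityMatrix (τ l)) ∧
        ρ = W.U * blockKronecker R τ * W.Uᴴ := by
  obtain ⟨R, τ, hR, hτ, h⟩ := h
  refine ⟨R, τ, posDef_of_posDef_blockKronecker hR (T := τ) ?_, hτ, h⟩
  have h1 := hρ.conjTranspose_mul_mul_same W.mulVec_U_injective
  rw [h] at h1
  rwa [← W.conjTranspose_mul_conj (blockKronecker R τ)]

/-- The conclusion no longer involves `W`; this is what makes compatibility independent of the
decomposition. -/
theorem HasBlockForm.normalizes {ρ : Matrix n n ℂ} (hρ : ρ.PosDef) (h : W.HasBlockForm ρ) :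
    ∀ X ∈ A, ∃ Y ∈ A, ρ * X = Y * ρ := by
  obtain ⟨R, τ, hR, hτ, rfl⟩ := h.exists_posDef W hρ
  intro X hX
  obtain ⟨M, rfl⟩ := (W.mem_iff_blockKronecker X).mp hX
  refine ⟨_, (W.mem_iff_blockKronecker _).mpr ⟨fun l => R l * M l * (R l)⁻¹, rfl⟩, ?_⟩
  rw [conj_mul_conj, conj_mul_conj, blockKronecker_mul_blockKronecker_one]
  exact fun l => nonsing_inv_mul _ (hR l).det_pos.ne'.isUnit

theorem hasBlockForm_of_normalizes {ρ : Matrix n n ℂ} (hρ : ρ.PosDef)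
    (h : ∀ X ∈ A, ∃ Y ∈ A, ρ * X = Y * ρ) : W.HasBlockForm ρ := by
  have hP : (W.Uᴴ * ρ * W.U).PosDef := hρ.conjTranspose_mul_mul_same W.mulVec_U_injective
  have hρP : ρ = W.U * (W.Uᴴ * ρ * W.U) * W.Uᴴ :=
    (W.conj_conjTranspose_mul ρ).symm
  obtain ⟨R, τ, hR, hτ, htr, hRτ⟩ := hP.exists_eq_blockKronecker fun M => by
    obtain ⟨Y, hY, hXY⟩ := h _ ((W.mem_iff_blockKronecker _).mpr ⟨M, rfl⟩)
    obtain ⟨N, rfl⟩ := (W.mem_iff_blockKronecker _).mp hY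
    refine ⟨N, W.conj_injective ?_⟩
    simp only [← conj_mul_conj, ← hρP, hXY]
  refine ⟨R, τ, fun l => (hR l).posSemidef, fun l => ⟨(hτ l).posSemidef, htr l⟩, ?_⟩
  rw [hRτ] at hρP
  exact hρP

end WedderburnDecomposition

/-! ### State extensions, Kraus maps and their duals -/

section

variable {n : Type*} [Fintype n] [DecidableEq n]

/-- If the dual of a conditional expectation onto `A` has fixed points `D_ρ(A)`, then `ρ` normalizes
`A`. -/
theorem IsStateExtension.normalizes {ρ : Matrix n n ℂ} (hρ : ρ.PosDef)
    {A : StarSubalgebra ℂ (Matrix n n ℂ)} {J : Matrix n n ℂ →ₗ[ℂ] Matrix n n ℂ}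
    (hJ : IsStateExtension A J) (hfix : Function.fixedPoints J = distortedAlgebra ρ A) :
    ∀ X ∈ A, ∃ Y ∈ A, ρ * X = Y * ρ := by
  obtain ⟨E, hE, hJE⟩ := hJ
  set σ := CFC.sqrt ρ with hσdef
  have hσ : σ * σ = ρ := CFC.sqrt_mul_sqrt_self ρ hρ.posSemidef.nonneg
  have hσu : IsUnit σ := hρ.isUnit_sqrt
  have hσs : σᴴ = σ := (nonneg_iff_posSemidef.mp (CFC.sqrt_nonneg ρ)).isHermitian.eq
  have hJρ : J ρ = ρ := by
    have : ρ ∈ Function.fixedPoints J := by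
      rw [hfix]
      exact ⟨1, one_mem A, by rw [distort, ← hσdef, mul_one, hσ]⟩
    exact this
  have hJa : ∀ a ∈ A, J (a * ρ) = a * ρ := by
    intro a ha
    -- Moving `star a` through `E` and dualizing back gives `J (a * ρ) = a * J ρ`.
    have h1 : ∀ Y, ((J (a * ρ))ᴴ * Y).trace = ((a * ρ)ᴴ * Y).trace := by
      intro Y
      rw [hJE, conjTranspose_mul, Matrix.mul_assoc, ← star_eq_conjTranspose a,
        ← hE.map_mul _ _ (star_mem ha), ← hJE, hJρ,
        Matrix.mul_assoc]
    exact conjTranspose_injective (ext_iff_trace_mul_right.mpr h1)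
  have h1 : ∀ a ∈ A, ∃ b ∈ A, a * σ = σ * b := by
    intro a ha
    have : a * ρ ∈ Function.fixedPoints J := hJa a ha
    rw [hfix] at this
    obtain ⟨b, hb, hab⟩ := this
    refine ⟨b, hb, hσu.mul_right_cancel ?_⟩
    rw [mul_assoc, hσ, ← hab, distort]
  have h2 : ∀ a ∈ A, ∃ b ∈ A, σ * a = b * σ := by
    intro a ha
    obtain ⟨b, hb, hab⟩ := h1 _ (star_mem ha)
    refine ⟨star b, star_mem hb, ?_⟩
    have := congrArg star hab
    simpa [star_eq_conjTranspose, hσs] using this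
  -- Two passes of `ρ^{1/2}` across `A` make one pass of `ρ`.
  intro a ha
  obtain ⟨b, hb, hab⟩ := h2 a ha
  obtain ⟨c, hc, hbc⟩ := h2 b hb
  exact ⟨c, hc, by rw [← hσ, mul_assoc, hab, ← mul_assoc, hbc, mul_assoc]⟩

/-- The completely positive map with given Kraus operators. -/
noncomputable def krausMap {ι : Type*} [Fintype ι] (K : ι → Matrix n n ℂ) :
    Matrix n n ℂ →CP Matrix n n ℂ where
  toFun X := ∑ k, (K k)ᴴ * X * K k
  map_add' X Y := by simp [mul_add, add_mul, Finset.sum_add_distrib]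
  map_smul' c X := by simp [Finset.smul_sum]
  map_cstarMatrix_nonneg' m M hM := by
    -- Amplifying `X ↦ (K k)ᴴ * X * K k` to `m × m` matrices gives conjugation by the diagonal
    -- matrix with entries `K k`, which preserves positivity.
    let D : ι → CStarMatrix (Fin m) (Fin m) (Matrix n n ℂ) := fun k =>
      CStarMatrix.ofMatrix (Matrix.diagonal fun _ => K k)
    have h : ∀ k, 0 ≤ star (D k) * M * D k := fun k => star_left_conjugate_nonneg hM _
    have h1 := Finset.sum_nonneg fun k (_ : k ∈ Finset.univ) => h k
    convert h1 using 1
    ext1 i j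
    have h2 : ∀ N : ι → CStarMatrix (Fin m) (Fin m) (Matrix n n ℂ),
        (∑ k, N k) i j = ∑ k, N k i j := fun N => Matrix.sum_apply i j Finset.univ N
    have h3 : ∀ k a b, D k a b = if a = b then K k else 0 := fun k a b =>
      Matrix.diagonal_apply ..
    have h4 : ∀ k a b, (star (D k)) a b = if a = b then (K k)ᴴ else 0 := fun k a b => by
      rw [CStarMatrix.star_apply, h3]
      by_cases hab : a = b
      · simp [hab, star_eq_conjTranspose]
      · simp [hab, Ne.symm hab]
    rw [h2]
    change ∑ k, (K k)ᴴ * M i j * K k = _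
    refine Finset.sum_congr rfl fun k _ => ?_
    simp [CStarMatrix.mul_apply, h3, h4]

theorem krausMap_apply {ι : Type*} [Fintype ι] (K : ι → Matrix n n ℂ) (X : Matrix n n ℂ) :
    krausMap K X = ∑ k, (K k)ᴴ * X * K k := rfl

/-- The Hilbert-Schmidt dual of the completely positive map with given Kraus operators. -/
noncomputable def krausDual {ι : Type*} [Fintype ι] (K : ι → Matrix n n ℂ) :
    Matrix n n ℂ →ₗ[ℂ] Matrix n n ℂ where
  toFun X := ∑ k, K k * X * (K k)ᴴ
  map_add' X Y := by simp [mul_add, add_mul, Finset.sum_add_distrib]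
  map_smul' c X := by simp [Finset.smul_sum]

theorem krausDual_apply {ι : Type*} [Fintype ι] (K : ι → Matrix n n ℂ) (X : Matrix n n ℂ) :
    krausDual K X = ∑ k, K k * X * (K k)ᴴ := rfl

theorem trace_krausDual_mul {ι : Type*} [Fintype ι] (K : ι → Matrix n n ℂ) (X Y : Matrix n n ℂ) :
    ((krausDual K X)ᴴ * Y).trace = (Xᴴ * krausMap K Y).trace := by
  simp only [krausDual_apply, krausMap_apply, conjTranspose_sum, Finset.sum_mul, Finset.mul_sum,
    trace_sum]
  refine Finset.sum_congr rfl fun k _ => ?_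
  rw [conjTranspose_mul, conjTranspose_mul, conjTranspose_conjTranspose, Matrix.mul_assoc,
    trace_mul_comm]
  simp only [Matrix.mul_assoc]

end

/-! ### The state extension built from a block form -/

namespace WedderburnDecomposition

variable {n : Type*} [Fintype n] [DecidableEq n] {A : StarSubalgebra ℂ (Matrix n n ℂ)}
  (W : WedderburnDecomposition A)

/-- The isometry `x ↦ U (x ⊗ e_j)` of the `l`-th system space. -/
noncomputable def isometry (l : Fin W.numBlocks) (j : Fin (W.dF l)) : Matrix n (Fin (W.dS l)) ℂ :=
  W.U.submatrix id fun i => ⟨l, i, j⟩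

theorem isometry_conjTranspose_mul_self (l : Fin W.numBlocks) (j j' : Fin (W.dF l)) :
    (W.isometry l j)ᴴ * W.isometry l j' = if j = j' then 1 else 0 := by
  ext i i'
  have := congrFun (congrFun W.conjTranspose_mul_self ⟨l, i, j⟩) ⟨l, i', j'⟩
  rw [mul_apply] at this
  rw [mul_apply]
  refine this.trans ?_
  by_cases hj : j = j' <;> simp [hj, one_apply]

theorem isometry_conjTranspose_mul_of_ne {l l' : Fin W.numBlocks} (h : l ≠ l') (j : Fin (W.dF l))
    (j' : Fin (W.dF l')) : (W.isometry l j)ᴴ * W.isometry l' j' = 0 := by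
  ext i i'
  have := congrFun (congrFun W.conjTranspose_mul_self ⟨l, i, j⟩) ⟨l', i', j'⟩
  rw [mul_apply] at this
  rw [mul_apply]
  refine this.trans ?_
  rw [one_apply_ne (by simp [h]), Matrix.zero_apply]

theorem conj_blockKronecker (M : ∀ l, Matrix (Fin (W.dS l)) (Fin (W.dS l)) ℂ)
    (T : ∀ l, Matrix (Fin (W.dF l)) (Fin (W.dF l)) ℂ) :
    W.U * blockKronecker M T * W.Uᴴ =
      ∑ l, ∑ j, ∑ j', T l j j' • (W.isometry l j * M l * (W.isometry l j')ᴴ) := by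
  ext x y
  rw [mul_apply, Fintype.sum_sigma]
  simp only [Matrix.sum_apply]
  refine Finset.sum_congr rfl fun l _ => ?_
  have h1 : ∀ k j', (W.U * blockKronecker M T) x ⟨l, k, j'⟩ =
      ∑ j, T l j j' * ∑ i, W.U x ⟨l, i, j⟩ * M l i k := by
    intro k j'
    rw [mul_apply, Fintype.sum_sigma, Finset.sum_eq_single_of_mem l (Finset.mem_univ _),
      Fintype.sum_prod_type_right]
    · refine Finset.sum_congr rfl fun j _ => ?_
      rw [Finset.mul_sum]
      refine Finset.sum_congr rfl fun i _ => ?_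
      rw [blockKronecker_apply_eq]
      ring
    · intro l' _ hl
      simp [blockKronecker_apply_ne _ _ hl]
  rw [Fintype.sum_prod_type_right]
  conv_rhs => rw [Finset.sum_comm]
  refine Finset.sum_congr rfl fun j' _ => ?_
  simp only [h1, Finset.sum_mul]
  rw [Finset.sum_comm]
  refine Finset.sum_congr rfl fun j _ => ?_
  simp only [Matrix.smul_apply, smul_eq_mul, mul_apply, Finset.mul_sum, conjTranspose_apply]
  refine Finset.sum_congr rfl fun k _ => ?_
  rw [← Finset.mul_sum, mul_assoc]
  rfl

theorem isometry_conjTranspose_mul_conj (M : ∀ l, Matrix (Fin (W.dS l)) (Fin (W.dS l)) ℂ)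
    (T : ∀ l, Matrix (Fin (W.dF l)) (Fin (W.dF l)) ℂ) (l : Fin W.numBlocks) (j : Fin (W.dF l)) :
    (W.isometry l j)ᴴ * (W.U * blockKronecker M T * W.Uᴴ) =
      ∑ j', T l j j' • (M l * (W.isometry l j')ᴴ) := by
  rw [conj_blockKronecker, Matrix.mul_sum, Finset.sum_eq_single_of_mem l (Finset.mem_univ _)]
  · simp only [Matrix.mul_sum, Matrix.mul_smul, ← Matrix.mul_assoc,
      isometry_conjTranspose_mul_self]
    rw [Finset.sum_eq_single_of_mem j (Finset.mem_univ _)]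
    · simp
    · intro j' _ hj
      simp [hj.symm]
  · intro l' _ hl
    simp only [Matrix.mul_sum, Matrix.mul_smul, ← Matrix.mul_assoc,
      W.isometry_conjTranspose_mul_of_ne hl.symm, Matrix.zero_mul, smul_zero,
      Finset.sum_const_zero]

/-- The operators `x ↦ U (x ⊗ v)`, where `v` is the `a`-th row of `S l`, conjugated. -/
noncomputable def weightedIsometry (S : ∀ l, Matrix (Fin (W.dF l)) (Fin (W.dF l)) ℂ)
    (l : Fin W.numBlocks) (a : Fin (W.dF l)) : Matrix n (Fin (W.dS l)) ℂ :=
  ∑ j, star (S l a j) • W.isometry l j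

theorem conjTranspose_weightedIsometry (S : ∀ l, Matrix (Fin (W.dF l)) (Fin (W.dF l)) ℂ)
    (l : Fin W.numBlocks) (a : Fin (W.dF l)) :
    (W.weightedIsometry S l a)ᴴ = ∑ j, S l a j • (W.isometry l j)ᴴ := by
  simp [weightedIsometry, conjTranspose_sum, conjTranspose_smul]

/-- Kraus operators of the conditional expectation with weights `(S l)ᴴ * S l`. -/
noncomputable def kraus (S : ∀ l, Matrix (Fin (W.dF l)) (Fin (W.dF l)) ℂ)
    (k : Σ l : Fin W.numBlocks, Fin (W.dF l) × Fin (W.dF l)) : Matrix n n ℂ :=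
  W.weightedIsometry S k.1 k.2.1 * (W.isometry k.1 k.2.2)ᴴ

variable (S : ∀ l, Matrix (Fin (W.dF l)) (Fin (W.dF l)) ℂ)

/-- With `τ l = (S l)ᴴ * S l`, this is the weighted partial trace `X ↦ ⨁ tr_F((1 ⊗ τ l) X_l) ⊗ 1`:
the sum over `a` produces the weight, the sum over `b` the identity on the second factor. -/
theorem krausMap_kraus (X : Matrix n n ℂ) :
    krausMap (W.kraus S) X = W.U * blockKronecker
      (fun l => ∑ a, (W.weightedIsometry S l a)ᴴ * X * W.weightedIsometry S l a)
      (fun l => (1 : Matrix (Fin (W.dF l)) (Fin (W.dF l)) ℂ)) * W.Uᴴ := by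
  rw [conj_blockKronecker, krausMap_apply, Fintype.sum_sigma]
  refine Finset.sum_congr rfl fun l _ => ?_
  rw [Fintype.sum_prod_type_right]
  refine Finset.sum_congr rfl fun b _ => ?_
  simp [kraus, one_apply, ite_smul, Matrix.mul_sum, Matrix.sum_mul, Matrix.mul_assoc]

/-- The two indices exchange roles: `b` now gives the plain partial trace and `a` rebuilds the
weight as second factor. -/
theorem krausDual_kraus (X : Matrix n n ℂ) :
    krausDual (W.kraus S) X = W.U * blockKronecker
      (fun l => ∑ b, (W.isometry l b)ᴴ * X * W.isometry l b)
      (fun l => (S l)ᴴ * S l) * W.Uᴴ := by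
  rw [conj_blockKronecker, krausDual_apply, Fintype.sum_sigma]
  refine Finset.sum_congr rfl fun l _ => ?_
  have h1 : ∀ a b, W.kraus S ⟨l, a, b⟩ * X * (W.kraus S ⟨l, a, b⟩)ᴴ =
      W.weightedIsometry S l a * ((W.isometry l b)ᴴ * X * W.isometry l b) *
        (W.weightedIsometry S l a)ᴴ := by
    intro a b
    simp [kraus, Matrix.mul_assoc]
  simp only [Fintype.sum_prod_type, h1]
  simp only [← Matrix.mul_sum, ← Matrix.sum_mul]
  set Z := ∑ b, (W.isometry l b)ᴴ * X * W.isometry l b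
  have h2 : ∀ a, W.weightedIsometry S l a * Z * (W.weightedIsometry S l a)ᴴ =
      ∑ j, ∑ j', (star (S l a j) * S l a j') • (W.isometry l j * Z * (W.isometry l j')ᴴ) := by
    intro a
    rw [conjTranspose_weightedIsometry, weightedIsometry]
    simp only [Matrix.sum_mul, Matrix.mul_sum, Matrix.smul_mul, Matrix.mul_smul,
      Finset.smul_sum, smul_smul]
    rw [Finset.sum_comm]
    simp only [mul_comm]
  simp only [h2, mul_apply, conjTranspose_apply, Finset.sum_smul]
  rw [Finset.sum_comm]
  refine Finset.sum_congr rfl fun j _ => ?_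
  rw [Finset.sum_comm]

/-- Unitality is the normalization of the weights; the module property holds because elements of `A`
act on the first factors alone and pass through the adjoint isometries. -/
theorem isConditionalExpectation_krausMap (hS : ∀ l, ((S l)ᴴ * S l).trace = 1) :
    IsConditionalExpectation A (krausMap (W.kraus S)) where
  mem X := (W.mem_iff_blockKronecker _).mpr ⟨_, W.krausMap_kraus S X⟩
  map_one := by
    have h1 : ∀ l, ∑ a, (W.weightedIsometry S l a)ᴴ * (1 : Matrix n n ℂ) *
        W.weightedIsometry S l a = 1 := by
      intro l
      simp only [conjTranspose_weightedIsometry, Matrix.mul_one]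
      simp only [weightedIsometry, Matrix.sum_mul, Matrix.mul_sum, Matrix.smul_mul,
        Matrix.mul_smul, isometry_conjTranspose_mul_self]
      have h2 := hS l
      simp only [trace, diag_apply, mul_apply, conjTranspose_apply] at h2
      simp only [smul_ite, smul_zero, Finset.sum_ite_eq', Finset.mem_univ,
        if_true, smul_smul, ← Finset.sum_smul]
      rw [Finset.sum_comm, h2, one_smul]
    rw [krausMap_kraus]
    simp only [h1]
    rw [blockKronecker_one, Matrix.mul_one, W.mul_conjTranspose_self]
  map_mul X Y hX := by
    obtain ⟨M, rfl⟩ := (W.mem_iff_blockKronecker X).mp hX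
    have h1 : ∀ l a, (W.weightedIsometry S l a)ᴴ * (W.U * blockKronecker M
        (fun l => (1 : Matrix (Fin (W.dF l)) (Fin (W.dF l)) ℂ)) * W.Uᴴ) =
        M l * (W.weightedIsometry S l a)ᴴ := by
      intro l a
      rw [conjTranspose_weightedIsometry, Matrix.sum_mul, Matrix.mul_sum]
      refine Finset.sum_congr rfl fun j _ => ?_
      rw [Matrix.smul_mul, isometry_conjTranspose_mul_conj, Matrix.mul_smul]
      simp [one_apply]
    rw [krausMap_kraus, krausMap_kraus, conj_mul_conj, blockKronecker_mul]
    simp only [← Matrix.mul_assoc _ _ Y, h1, Matrix.mul_one, Matrix.mul_sum]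
    simp only [Matrix.mul_assoc]

/-- The partial trace of `N l ⊗ τ l` is `N l`, as the weight has trace one. -/
theorem krausDual_kraus_conj (hS : ∀ l, ((S l)ᴴ * S l).trace = 1)
    (N : ∀ l, Matrix (Fin (W.dS l)) (Fin (W.dS l)) ℂ) :
    krausDual (W.kraus S) (W.U * blockKronecker N (fun l => (S l)ᴴ * S l) * W.Uᴴ) =
      W.U * blockKronecker N (fun l => (S l)ᴴ * S l) * W.Uᴴ := by
  have h1 : ∀ l, ∑ b, (W.isometry l b)ᴴ *
      (W.U * blockKronecker N (fun l => (S l)ᴴ * S l) * W.Uᴴ) * W.isometry l b = N l := by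
    intro l
    simp only [isometry_conjTranspose_mul_conj, Matrix.sum_mul, Matrix.smul_mul,
      Matrix.mul_assoc (N l), isometry_conjTranspose_mul_self]
    have h2 := hS l
    rw [trace] at h2
    calc _ = ∑ b, ((S l)ᴴ * S l) b b • N l := Finset.sum_congr rfl fun b _ => by simp
      _ = N l := by rw [← Finset.sum_smul]; exact (congrArg (· • N l) h2).trans (one_smul _ _)
  rw [krausDual_kraus]
  simp only [h1]

/-- The root of `ρ` is again a block product `r ⊗ t`, so distortion sends `M ⊗ 1` to `r M r ⊗ τ`. As
`r` is invertible, `A_ρ` is all of `⨁ B ⊗ τ l`, onto which the weighted dual map projects. -/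
theorem HasBlockForm.exists_isStateExtension {ρ : Matrix n n ℂ} (hρ : ρ.PosDef)
    (h : W.HasBlockForm ρ) :
    ∃ J : Matrix n n ℂ →ₗ[ℂ] Matrix n n ℂ, IsStateExtension A J ∧
      Set.range J = distortedAlgebra ρ A ∧ Function.fixedPoints J = distortedAlgebra ρ A := by
  obtain ⟨R, τ, hR, hτ, h⟩ := h.exists_posDef W hρ
  choose r hr hrr using fun l => (hR l).exists_posDef_mul_self
  have htt : ∀ l, CFC.sqrt (τ l) * CFC.sqrt (τ l) = τ l := fun l =>
    CFC.sqrt_mul_sqrt_self _ (hτ l).1.nonneg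
  have ht : ∀ l, (CFC.sqrt (τ l)).PosSemidef := fun l =>
    nonneg_iff_posSemidef.mp (CFC.sqrt_nonneg _)
  set t := fun l => CFC.sqrt (τ l) with htdef
  have htτ : (fun l => (t l)ᴴ * t l) = τ := funext fun l => by
    rw [(ht l).isHermitian.eq]
    exact htt l
  have htr : ∀ l, ((t l)ᴴ * t l).trace = 1 := fun l => by
    rw [(ht l).isHermitian.eq]
    exact (congrArg trace (htt l)).trans (hτ l).2
  have hσ : CFC.sqrt ρ = W.U * blockKronecker r t * W.Uᴴ := by
    refine CFC.sqrt_unique ?_ ?_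
    · rw [conj_mul_conj, blockKronecker_mul, h]
      congr 3
      · exact funext hrr
      · exact funext htt
    · rw [nonneg_iff_posSemidef]
      exact (PosSemidef.blockKronecker (fun l => (hr l).posSemidef) ht).mul_mul_conjTranspose_same _
  have hdist : ∀ M : ∀ l, Matrix (Fin (W.dS l)) (Fin (W.dS l)) ℂ,
      distort ρ (W.U * blockKronecker M
        (fun l => (1 : Matrix (Fin (W.dF l)) (Fin (W.dF l)) ℂ)) * W.Uᴴ) =
      W.U * blockKronecker (fun l => r l * M l * r l) τ * W.Uᴴ := by
    intro M
    rw [distort, hσ, conj_mul_conj, conj_mul_conj, blockKronecker_mul, blockKronecker_mul]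
    simp only [Matrix.mul_one]
    congr 3
    exact funext htt
  have hsub : distortedAlgebra ρ A ⊆ Function.fixedPoints (krausDual (W.kraus t)) := by
    rintro _ ⟨X, hX, rfl⟩
    obtain ⟨M, rfl⟩ := (W.mem_iff_blockKronecker X).mp hX
    rw [hdist, ← htτ]
    exact W.krausDual_kraus_conj t htr _
  have hrange : Set.range (krausDual (W.kraus t)) ⊆ distortedAlgebra ρ A := by
    rintro _ ⟨X, rfl⟩
    rw [krausDual_kraus, htτ]
    set Z := fun l => ∑ b, (W.isometry l b)ᴴ * X * W.isometry l b
    refine ⟨_, (W.mem_iff_blockKronecker _).mpr ⟨fun l => (r l)⁻¹ * Z l * (r l)⁻¹, rfl⟩, ?_⟩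
    rw [hdist]
    congr 3
    funext l
    have hu := (hr l).det_pos.ne'.isUnit
    rw [← Matrix.mul_assoc, ← Matrix.mul_assoc, mul_nonsing_inv _ hu, Matrix.one_mul,
      Matrix.mul_assoc, nonsing_inv_mul _ hu, Matrix.mul_one]
  have hfix : Function.fixedPoints (krausDual (W.kraus t)) ⊆ Set.range (krausDual (W.kraus t)) :=
    fun X hX => ⟨X, hX⟩
  exact ⟨krausDual (W.kraus t), ⟨krausMap (W.kraus t), W.isConditionalExpectation_krausMap t htr,
    trace_krausDual_mul _⟩, hrange.antisymm (hsub.trans hfix), (hfix.trans hrange).antisymm hsub⟩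

end WedderburnDecomposition

/-! ### The equivalence and independence of the decomposition -/

theorem mainTheorem5 {n : Type*} [Fintype n] [DecidableEq n] (ρ : Matrix n n ℂ)
    (hρ : ρ.PosDef) (A : StarSubalgebra ℂ (Matrix n n ℂ)) :
    ((∃ J : Matrix n n ℂ →ₗ[ℂ] Matrix n n ℂ, IsStateExtension A J ∧
        Set.range J = distortedAlgebra ρ A ∧
        Function.fixedPoints J = distortedAlgebra ρ A) ↔
      IsCompatible ρ A) ∧
    (∀ W : WedderburnDecomposition A, W.HasBlockForm ρ ↔ IsCompatible ρ A) := by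
  refine ⟨⟨?_, ?_⟩, fun W => ⟨fun h => ⟨W, h⟩, ?_⟩⟩
  · rintro ⟨J, hJ, -, hfix⟩
    obtain ⟨W⟩ := A.nonempty_wedderburnDecomposition
    exact ⟨W, W.hasBlockForm_of_normalizes hρ (hJ.normalizes hρ hfix)⟩
  · rintro ⟨W, h⟩
    exact h.exists_isStateExtension W hρ
  · rintro ⟨W', h⟩
    exact W.hasBlockForm_of_normalizes hρ (h.normalizes W' hρ)
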